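/- A ReLU network of depth $L\in\{1,2,\dots\}$ with layer dimensions $\ell_0,\dots,\ell_L\ge 1$ is given by weight matrices $W_k\in\mathbb R^{\ell_k\times\ell_{k-1}}$ and biases $b_k\in\mathbb R^{\ell_k}$, $k=1,\dots,L$. It realizes the map $A_L\circ\varrho\circ A_{L-1}\circ\cdots\circ\varrho\circ A_1:\mathbb R^{\ell_0}\to\mathbb R^{\ell_L}$, where $A_k(x)=W_kx+b_k$ and $\varrho(t)=\max\{t,0\}$ is applied componentwise. Its width is $\max\{\ell_1,\dots,\ell_L\}$, and its weights are the entries of all $W_k$ and $b_k$. Let $\mathcal{NN}_{L,M,m,n}$ be the set of ReLU networks of depth at most $L$ and width at most $M$ with $\ell_0=m$ and $\ell_L=n$. There exist constants $C>0$, $B>0$ and $\epsilon_0>0$ such that for every $D>1$ and every $\epsilon\in(0,\epsilon_0)$ there exist $L\in\mathbb N$ and a ReLU network $\phi_{D,\epsilon}\in\mathcal{NN}_{L,13,1,1}$ with $$L\le C\,\bigl(\log(1/\epsilon)\bigr)^2\Bigl(\lceil\log D\rceil^2+\bigl(\log(1/\epsilon)\bigr)^2\Bigr),$$ such that $$\Bigl\|\frac1x-\phi_{D,\epsilon}(x)\Bigr\|_{L^\infty((1,D))}\le\epsilon,$$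 and all weights of $\phi_{D,\epsilon}$ are bounded in absolute value by $B$. The constants $C$, $B$ and $\epsilon_0$ depend neither on $D$ nor on $\epsilon$. -/

import Mathlib

/-- A feedforward network with input dimension `m` and output dimension `n`, given by its
weights and biases `(W₁, b₁), …, (W_L, b_L)` with `L ≥ 1`; the widths of the hidden layers are
positive. `affine W b` is the case `L = 1`, and `layer W b hk Φ` puts the affine map
`x ↦ W x + b`, followed by the activation, in front of the network `Φ`. -/
inductive DNN : ℕ → ℕ → Type
  | affine {m n : ℕ} (W : Matrix (Fin n) (Fin m) ℝ) (b : Fin n → ℝ) : DNN m n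
  | layer {m k n : ℕ} (W : Matrix (Fin k) (Fin m) ℝ) (b : Fin k → ℝ) (hk : 0 < k)
      (Φ : DNN k n) : DNN m n

namespace DNN

/-- The map `A_L ∘ ϱ ∘ A_{L-1} ∘ ⋯ ∘ ϱ ∘ A_1` realized by the network, where the activation
`ϱ` acts componentwise and `A_k x = W_k x + b_k`. -/
def realize (ϱ : ℝ → ℝ) : {m n : ℕ} → DNN m n → (Fin m → ℝ) → (Fin n → ℝ)
  | _, _, affine W b, x => W.mulVec x + b
  | _, _, layer W b _ Φ, x => Φ.realize ϱ (fun i => ϱ ((W.mulVec x + b) i))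

/-- The depth `L`, that is, the number of affine maps. -/
def depth : {m n : ℕ} → DNN m n → ℕ
  | _, _, affine _ _ => 1
  | _, _, layer _ _ _ Φ => Φ.depth + 1

/-- The width `max {ℓ_1, …, ℓ_L}` (the input dimension `ℓ_0` is not counted). -/
def width : {m n : ℕ} → DNN m n → ℕ
  | _, n, affine _ _ => n
  | _, _, layer (k := k) _ _ _ Φ => max k Φ.width

/-- The largest absolute value of an entry of a matrix. -/
noncomputable def entryNorm {m n : ℕ} (W : Matrix (Fin n) (Fin m) ℝ) : ℝ :=
  ‖(fun i j => W i j : Fin n → Fin m → ℝ)‖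

/-- The weight bound: the largest absolute value of an entry of a weight matrix or of a bias
vector (`‖b‖` is the sup norm on `Fin n → ℝ`). -/
noncomputable def weightBound : {m n : ℕ} → DNN m n → ℝ
  | _, _, affine W b => max (entryNorm W) ‖b‖
  | _, _, layer W b _ Φ => max (max (entryNorm W) ‖b‖) Φ.weightBound

end DNN

/-- The class of networks with depth at most `L`, width at most `M`, input dimension `m` and
output dimension `n`. -/
def NN (L M m n : ℕ) : Set (DNN m n) :=
  {Φ | Φ.depth ≤ L ∧ Φ.width ≤ M}

/-- The rectified linear unit. -/
noncomputable def relu (x : ℝ) : ℝ := max x 0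

/-- The function `ℝ → ℝ` realized by a ReLU network with one input and one output. -/
noncomputable def DNN.reluFun (Φ : DNN 1 1) (x : ℝ) : ℝ :=
  Φ.realize relu (fun _ => x) 0

open DNN

/-! Choose `N` with `2 * (1 / 2) ^ N ≤ ε` and put `z = max (1 - x / 2 ^ N) 0`. For `x ≤ 2 ^ N`, `1 /
x` is `2 ^ (-N)` times the geometric series in `z`; its partial sum with `4 ^ N` terms factors,
giving `2 ^ N * ∏_{i < 2N} (1 + z ^ (2 ^ i)) / 2`, and the remainder is at most `2 ^ (-N)`. For `x ≥
2 ^ N` both this value and `1 / x` lie in `[0, 2 ^ (-N)]`. Hence one network serves all `x > 1`,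
whatever `D` (`abs_inv_sub_geomProd_le`).

The product arises by iterating `(z, p) ↦ (z ^ 2, p * ((1 + z) / 2))`, which preserves the unit
square. One step needs only squares of numbers in `[0, 1]`, computed by iterated tent maps, plus
polarization (`exists_sqMulStep_pairState`). With `4N` tent layers per step, the accumulated error
stays below `4 ^ (-N)` (`exists_sqMulStep_iterate`). The factor `2 ^ N` is applied by `N` doubling
layers, so weights stay bounded. The depth is of order `N ^ 2`, with `N` of order `log (1 / ε)`. -/

theorem DNN.entryNorm_le {m n : ℕ} {W : Matrix (Fin n) (Fin m) ℝ} {B : ℝ} (hB : 0 ≤ B)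
    (h : ∀ i j, |W i j| ≤ B) : entryNorm W ≤ B := by
  unfold entryNorm
  refine (pi_norm_le_iff_of_nonneg hB).2 fun i => (pi_norm_le_iff_of_nonneg hB).2 fun j => ?_
  simpa [Real.norm_eq_abs] using h i j

/-! ### Bounded affine forms and composable ReLU blocks -/

/-- `f` is an affine form whose coefficients and constant term are bounded by `B`. -/
def IsBoundedAffine {d : ℕ} (B : ℝ) (f : (Fin d → ℝ) → ℝ) : Prop :=
  ∃ (w : Fin d → ℝ) (c : ℝ), (∀ j, |w j| ≤ B) ∧ |c| ≤ B ∧ ∀ s, f s = (∑ j, w j * s j) + c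

namespace IsBoundedAffine

variable {d : ℕ} {B B' : ℝ} {f g : (Fin d → ℝ) → ℝ}

theorem mono (hf : IsBoundedAffine B f) (h : B ≤ B') : IsBoundedAffine B' f := by
  obtain ⟨w, c, hw, hc, hs⟩ := hf
  exact ⟨w, c, fun j => (hw j).trans h, hc.trans h, hs⟩

theorem coord (i : Fin d) : IsBoundedAffine 1 (fun s : Fin d → ℝ => s i) := by
  refine ⟨Pi.single i 1, 0, fun j => ?_, by simp, fun s => ?_⟩
  · by_cases h : j = i
    · subst h; simp
    · simp [h]
  · simp [Pi.single_apply]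

theorem const (c : ℝ) : IsBoundedAffine |c| (fun _ : Fin d → ℝ => c) :=
  ⟨0, c, by simp, le_rfl, by simp⟩

theorem add (hf : IsBoundedAffine B f) (hg : IsBoundedAffine B' g) :
    IsBoundedAffine (B + B') (fun s => f s + g s) := by
  obtain ⟨w, c, hw, hc, hs⟩ := hf
  obtain ⟨w', c', hw', hc', hs'⟩ := hg
  refine ⟨w + w', c + c', fun j => (abs_add_le _ _).trans (add_le_add (hw j) (hw' j)),
    (abs_add_le _ _).trans (add_le_add hc hc'), fun s => ?_⟩
  simp only [hs, hs', Pi.add_apply, add_mul, Finset.sum_add_distrib]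
  ring

theorem const_mul (a : ℝ) (hf : IsBoundedAffine B f) :
    IsBoundedAffine (|a| * B) (fun s => a * f s) := by
  obtain ⟨w, c, hw, hc, hs⟩ := hf
  refine ⟨fun j => a * w j, a * c, fun j => ?_, ?_, fun s => ?_⟩
  · rw [abs_mul]; exact mul_le_mul_of_nonneg_left (hw j) (abs_nonneg a)
  · rw [abs_mul]; exact mul_le_mul_of_nonneg_left hc (abs_nonneg a)
  · simp only [hs, mul_add, Finset.mul_sum, mul_assoc]

theorem sub (hf : IsBoundedAffine B f) (hg : IsBoundedAffine B' g) :
    IsBoundedAffine (B + B') (fun s => f s - g s) := by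
  have h := hf.add (hg.const_mul (-1))
  simpa [sub_eq_add_neg] using h

end IsBoundedAffine

/-- `T` is computed by `n` ReLU layers of width `d` with weights bounded by `B`: it can be put in
front of any network. -/
def IsReluBlock {d e : ℕ} (B : ℝ) (n : ℕ) (T : (Fin d → ℝ) → (Fin e → ℝ)) : Prop :=
  ∀ Φ : DNN e 1, ∃ Ψ : DNN d 1, Ψ.depth = n + Φ.depth ∧ Ψ.width ≤ max e Φ.width ∧
    Ψ.weightBound ≤ max B Φ.weightBound ∧ ∀ x, Ψ.realize relu x = Φ.realize relu (T x)

namespace IsReluBlock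

variable {d e : ℕ} {B : ℝ}

theorem id : IsReluBlock B 0 (fun s : Fin d → ℝ => s) := fun Φ =>
  ⟨Φ, by simp, le_max_right _ _, le_max_right _ _, fun _ => rfl⟩

theorem comp {n m : ℕ} {S : (Fin e → ℝ) → (Fin e → ℝ)} {T : (Fin d → ℝ) → (Fin e → ℝ)}
    (hS : IsReluBlock B n S) (hT : IsReluBlock B m T) :
    IsReluBlock B (n + m) (fun s => S (T s)) := by
  intro Φ
  obtain ⟨Ψ, h1, h2, h3, h4⟩ := hS Φ
  obtain ⟨Ω, g1, g2, g3, g4⟩ := hT Ψ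
  refine ⟨Ω, by omega, g2.trans (max_le (le_max_left _ _) h2),
    g3.trans (max_le (le_max_left _ _) h3), fun x => by rw [g4, h4]⟩

theorem iterate {n : ℕ} {S : (Fin d → ℝ) → (Fin d → ℝ)} (hS : IsReluBlock B n S) (k : ℕ) :
    IsReluBlock B (k * n) (S^[k]) := by
  induction k with
  | zero => rw [Nat.zero_mul]; exact id
  | succ k ih =>
    rw [Function.iterate_succ', Nat.succ_mul, Nat.add_comm]
    exact hS.comp ih

theorem layer (he : 0 < e) {F : Fin e → (Fin d → ℝ) → ℝ} (hF : ∀ i, IsBoundedAffine B (F i)) :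
    IsReluBlock B 1 (fun s i => relu (F i s)) := by
  choose w c hw hc hs using hF
  have hB : 0 ≤ B := (abs_nonneg _).trans (hc ⟨0, he⟩)
  intro Φ
  refine ⟨.layer (Matrix.of w) c he Φ, ?_, le_rfl, ?_, fun x => ?_⟩
  · simp [depth, Nat.add_comm]
  · refine max_le_max (max_le (entryNorm_le hB fun i j => hw i j) ?_) le_rfl
    exact (pi_norm_le_iff_of_nonneg hB).2 fun i => by simpa using hc i
  · simp only [realize]
    congr 1
    funext i
    simp [hs, Matrix.mulVec, dotProduct]

end IsReluBlock

theorem relu_of_nonneg {x : ℝ} (h : 0 ≤ x) : relu x = x := max_eq_left h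

theorem relu_nonneg (x : ℝ) : 0 ≤ relu x := le_max_right _ _

/-! ### Squaring by tent maps -/

/-- The tent map, in the form in which two ReLU units compute it. -/
noncomputable def tent (t : ℝ) : ℝ := 2 * t - 4 * relu (t - 1 / 2)

theorem tent_eq (t : ℝ) : tent t = if t ≤ 1 / 2 then 2 * t else 2 - 2 * t := by
  unfold tent relu
  split_ifs with h
  · rw [max_eq_right (by linarith)]; ring
  · rw [max_eq_left (by linarith)]; ring

theorem tent_mem {t : ℝ} (ht : t ∈ Set.Icc (0 : ℝ) 1) : tent t ∈ Set.Icc (0 : ℝ) 1 := by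
  obtain ⟨h0, h1⟩ := ht
  rw [tent_eq]
  split_ifs <;> constructor <;> linarith

theorem tent_iterate_mem {t : ℝ} (ht : t ∈ Set.Icc (0 : ℝ) 1) (n : ℕ) :
    tent^[n] t ∈ Set.Icc (0 : ℝ) 1 := by
  induction n with
  | zero => exact ht
  | succ n ih => rw [Function.iterate_succ_apply']; exact tent_mem ih

/-- With `g t = t - t ^ 2` this is `g = (tent + g ∘ tent) / 4`; iterating it expands `t ^ 2` as `t`
minus the sum of `tent^[j] t / 4 ^ j` over `j ≥ 1`. -/
theorem four_mul_sub_sq (t : ℝ) : 4 * (t - t ^ 2) = tent t + (tent t - tent t ^ 2) := by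
  rw [tent_eq]
  split_ifs <;> ring

/-- The approximation of `t ^ 2` by the piecewise linear interpolation on the dyadic grid of
mesh `2 ^ (-n)`. -/
noncomputable def dyadicSq (n : ℕ) (t : ℝ) : ℝ :=
  t ^ 2 + (1 / 4) ^ n * (tent^[n] t - tent^[n] t ^ 2)

theorem dyadicSq_zero (t : ℝ) : dyadicSq 0 t = t := by simp [dyadicSq]

theorem dyadicSq_succ (n : ℕ) (t : ℝ) :
    dyadicSq (n + 1) t = dyadicSq n t - (1 / 4) ^ (n + 1) * tent (tent^[n] t) := by
  have := four_mul_sub_sq (tent^[n] t)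
  simp only [dyadicSq, Function.iterate_succ_apply', pow_succ (1 / 4 : ℝ) n]
  linear_combination (-(1 / 4) ^ n / 4) * this

theorem sq_le_dyadicSq {t : ℝ} (ht : t ∈ Set.Icc (0 : ℝ) 1) (n : ℕ) : t ^ 2 ≤ dyadicSq n t := by
  obtain ⟨h0, h1⟩ := tent_iterate_mem ht n
  have : 0 ≤ tent^[n] t - tent^[n] t ^ 2 := by nlinarith
  unfold dyadicSq
  have : 0 ≤ (1 / 4 : ℝ) ^ n * (tent^[n] t - tent^[n] t ^ 2) := by positivity
  linarith

theorem dyadicSq_le (t : ℝ) (n : ℕ) : dyadicSq n t ≤ t ^ 2 + (1 / 4) ^ n / 4 := by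
  have h : tent^[n] t - tent^[n] t ^ 2 ≤ 1 / 4 := by nlinarith [sq_nonneg (tent^[n] t - 1 / 2)]
  have := mul_le_mul_of_nonneg_left h (by positivity : (0 : ℝ) ≤ (1 / 4) ^ n)
  unfold dyadicSq
  linarith

/-! ### Layers of width ten -/

/-- The affine forms of a layer that advances three tent iterations and accumulates the
corresponding squares, with weight `c`; the last unit is a memory cell. -/
noncomputable def tentForms (c : ℝ) : Fin 10 → (Fin 10 → ℝ) → ℝ :=
  ![fun s => 2 * s 0 - 4 * s 1, fun s => 2 * s 0 - 4 * s 1 - 1 / 2,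
    fun s => s 2 - c * (2 * s 0 - 4 * s 1),
    fun s => 2 * s 3 - 4 * s 4, fun s => 2 * s 3 - 4 * s 4 - 1 / 2,
    fun s => s 5 - c * (2 * s 3 - 4 * s 4),
    fun s => 2 * s 6 - 4 * s 7, fun s => 2 * s 6 - 4 * s 7 - 1 / 2,
    fun s => s 8 - c * (2 * s 6 - 4 * s 7), fun s => s 9]

/-- The affine forms that start the tent iterations at `z`, `p` and `(p + (1 + z) / 2) / 2`,
where `z` and `p` are the first two units. -/
noncomputable def startForms : Fin 10 → (Fin 10 → ℝ) → ℝ :=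
  ![fun s => s 0, fun s => s 0 - 1 / 2, fun s => s 0,
    fun s => s 1, fun s => s 1 - 1 / 2, fun s => s 1,
    fun s => 1 / 2 * s 1 + 1 / 4 * s 0 + 1 / 4,
    fun s => 1 / 2 * s 1 + 1 / 4 * s 0 + 1 / 4 - 1 / 2,
    fun s => 1 / 2 * s 1 + 1 / 4 * s 0 + 1 / 4, fun s => s 0]

/-- The affine forms that read off one minus the approximations of `z ^ 2` and
`p * ((1 + z) / 2)`, the latter by polarization. -/
noncomputable def readForms : Fin 10 → (Fin 10 → ℝ) → ℝ :=
  ![fun s => 1 - s 2,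
    fun s => 1 - (2 * s 8 - 1 / 2 * s 5 - 1 / 8 * (1 + 2 * s 9 + s 2)),
    fun _ => 0, fun _ => 0, fun _ => 0, fun _ => 0, fun _ => 0, fun _ => 0, fun _ => 0, fun _ => 0]

/-- Applied after `readForms`, this completes `u ↦ relu (1 - relu (1 - u))`, the truncation to `[0,
1]` that readies the values for the next squaring. -/
noncomputable def complForms : Fin 10 → (Fin 10 → ℝ) → ℝ :=
  ![fun s => 1 - s 0, fun s => 1 - s 1,
    fun _ => 0, fun _ => 0, fun _ => 0, fun _ => 0, fun _ => 0, fun _ => 0, fun _ => 0, fun _ => 0]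

/-- Repeated doubling replaces a single weight `2 ^ N`, which would be unbounded. -/
noncomputable def doubleForms : Fin 10 → (Fin 10 → ℝ) → ℝ :=
  ![fun s => s 0, fun s => 2 * s 1,
    fun _ => 0, fun _ => 0, fun _ => 0, fun _ => 0, fun _ => 0, fun _ => 0, fun _ => 0, fun _ => 0]

noncomputable def inputForms (a : ℝ) : Fin 10 → (Fin 1 → ℝ) → ℝ :=
  ![fun s => 1 - a * s 0, fun _ => 1,
    fun _ => 0, fun _ => 0, fun _ => 0, fun _ => 0, fun _ => 0, fun _ => 0, fun _ => 0, fun _ => 0]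

open IsBoundedAffine in
theorem isBoundedAffine_tentForms {c : ℝ} (h0 : 0 ≤ c) (h1 : c ≤ 1) (i : Fin 10) :
    IsBoundedAffine 8 (tentForms c i) := by
  have g (i j : Fin 10) : IsBoundedAffine 6 (fun s : Fin 10 → ℝ => 2 * s i - 4 * s j) :=
    (((coord i).const_mul 2).sub ((coord j).const_mul 4)).mono (by norm_num)
  have a (i j : Fin 10) : IsBoundedAffine 8 (fun s : Fin 10 → ℝ => 2 * s i - 4 * s j) :=
    (g i j).mono (by norm_num)
  have b (i j : Fin 10) : IsBoundedAffine 8 (fun s : Fin 10 → ℝ => 2 * s i - 4 * s j - 1 / 2) :=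
    ((g i j).sub (const (1 / 2))).mono (by norm_num [abs_of_nonneg])
  have r (i j k : Fin 10) :
      IsBoundedAffine 8 (fun s : Fin 10 → ℝ => s k - c * (2 * s i - 4 * s j)) :=
    ((coord k).sub ((g i j).const_mul c)).mono (by rw [abs_of_nonneg h0]; linarith)
  fin_cases i
  exacts [a 0 1, b 0 1, r 0 1 2, a 3 4, b 3 4, r 3 4 5, a 6 7, b 6 7, r 6 7 8,
    (coord 9).mono (by norm_num)]

open IsBoundedAffine in
theorem isBoundedAffine_startForms (i : Fin 10) : IsBoundedAffine 8 (startForms i) := by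
  have a (i : Fin 10) : IsBoundedAffine 8 (fun s : Fin 10 → ℝ => s i) :=
    (coord i).mono (by norm_num)
  have b (i : Fin 10) : IsBoundedAffine 8 (fun s : Fin 10 → ℝ => s i - 1 / 2) :=
    ((coord i).sub (const (1 / 2))).mono (by norm_num [abs_of_nonneg])
  have m : IsBoundedAffine 1 (fun s : Fin 10 → ℝ => 1 / 2 * s 1 + 1 / 4 * s 0 + 1 / 4) :=
    ((((coord 1).const_mul (1 / 2)).add ((coord 0).const_mul (1 / 4))).add (const (1 / 4))).mono
      (by norm_num [abs_of_nonneg])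
  have m' := m.mono (B' := 8) (by norm_num)
  have n : IsBoundedAffine 8
      (fun s : Fin 10 → ℝ => 1 / 2 * s 1 + 1 / 4 * s 0 + 1 / 4 - 1 / 2) :=
    (m.sub (const (1 / 2))).mono (by norm_num [abs_of_nonneg])
  fin_cases i
  exacts [a 0, b 0, a 0, a 1, b 1, a 1, m', n, m', a 0]

open IsBoundedAffine in
theorem isBoundedAffine_readForms (i : Fin 10) : IsBoundedAffine 8 (readForms i) := by
  have z : IsBoundedAffine 8 (fun _ : Fin 10 → ℝ => (0 : ℝ)) := (const 0).mono (by norm_num)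
  have a : IsBoundedAffine 8 (fun s : Fin 10 → ℝ => 1 - s 2) :=
    ((const 1).sub (coord 2)).mono (by norm_num)
  have b : IsBoundedAffine 8 (fun s : Fin 10 → ℝ =>
      1 - (2 * s 8 - 1 / 2 * s 5 - 1 / 8 * (1 + 2 * s 9 + s 2))) :=
    ((const 1).sub ((((coord 8).const_mul 2).sub ((coord 5).const_mul (1 / 2))).sub
      ((((const 1).add ((coord 9).const_mul 2)).add (coord 2)).const_mul (1 / 8)))).mono
      (by norm_num [abs_of_nonneg])
  fin_cases i
  exacts [a, b, z, z, z, z, z, z, z, z]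

open IsBoundedAffine in
theorem isBoundedAffine_complForms (i : Fin 10) : IsBoundedAffine 8 (complForms i) := by
  have z : IsBoundedAffine 8 (fun _ : Fin 10 → ℝ => (0 : ℝ)) := (const 0).mono (by norm_num)
  have a (i : Fin 10) : IsBoundedAffine 8 (fun s : Fin 10 → ℝ => 1 - s i) :=
    ((const 1).sub (coord i)).mono (by norm_num)
  fin_cases i
  exacts [a 0, a 1, z, z, z, z, z, z, z, z]

open IsBoundedAffine in
theorem isBoundedAffine_doubleForms (i : Fin 10) : IsBoundedAffine 8 (doubleForms i) := by
  have z : IsBoundedAffine 8 (fun _ : Fin 10 → ℝ => (0 : ℝ)) := (const 0).mono (by norm_num)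
  fin_cases i
  exacts [(coord 0).mono (by norm_num), ((coord 1).const_mul 2).mono (by norm_num),
    z, z, z, z, z, z, z, z]

open IsBoundedAffine in
theorem isBoundedAffine_inputForms {a : ℝ} (h0 : 0 ≤ a) (h1 : a ≤ 1) (i : Fin 10) :
    IsBoundedAffine 8 (inputForms a i) := by
  have z : IsBoundedAffine 8 (fun _ : Fin 1 → ℝ => (0 : ℝ)) := (const 0).mono (by norm_num)
  have f : IsBoundedAffine 8 (fun s : Fin 1 → ℝ => 1 - a * s 0) :=
    ((const 1).sub ((coord 0).const_mul a)).mono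
      (by rw [abs_of_nonneg h0, abs_one]; linarith)
  fin_cases i
  exacts [f, (const 1).mono (by norm_num), z, z, z, z, z, z, z, z]

/-- `n` layers of tent iterations, with the weights of the dyadic squaring. -/
noncomputable def tentSteps : ℕ → (Fin 10 → ℝ) → (Fin 10 → ℝ)
  | 0 => fun s => s
  | n + 1 => fun s i => relu (tentForms ((1 / 4) ^ (n + 1)) i (tentSteps n s))

theorem isReluBlock_tentSteps (n : ℕ) : IsReluBlock 8 n (tentSteps n) := by
  induction n with
  | zero => exact .id
  | succ n ih =>
    have h := (IsReluBlock.layer (by norm_num) (isBoundedAffine_tentForms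
      (c := (1 / 4) ^ (n + 1)) (by positivity) (pow_le_one₀ (by norm_num) (by norm_num)))).comp ih
    rwa [Nat.add_comm] at h

/-- The state during the tent iterations started at `x`, `y`, `w`, with memory `q`. -/
noncomputable def tentState (n : ℕ) (x y w q : ℝ) : Fin 10 → ℝ :=
  ![tent^[n] x, relu (tent^[n] x - 1 / 2), dyadicSq n x,
    tent^[n] y, relu (tent^[n] y - 1 / 2), dyadicSq n y,
    tent^[n] w, relu (tent^[n] w - 1 / 2), dyadicSq n w, q]

/-- Tent iterates, dyadic squares and the memory cell are all nonnegative, so the ReLU leaves them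
unchanged. -/
theorem tentSteps_tentState {x y w q : ℝ} (hx : x ∈ Set.Icc (0 : ℝ) 1)
    (hy : y ∈ Set.Icc (0 : ℝ) 1) (hw : w ∈ Set.Icc (0 : ℝ) 1) (hq : 0 ≤ q) (n : ℕ) :
    tentSteps n (tentState 0 x y w q) = tentState n x y w q := by
  induction n with
  | zero => rfl
  | succ n ih =>
    have a {t : ℝ} (ht : t ∈ Set.Icc (0 : ℝ) 1) :
        relu (2 * tent^[n] t - 4 * relu (tent^[n] t - 1 / 2)) = tent^[n + 1] t := by
      rw [Function.iterate_succ_apply']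
      exact relu_of_nonneg (tent_mem (tent_iterate_mem ht n)).1
    have b (t : ℝ) : relu (2 * tent^[n] t - 4 * relu (tent^[n] t - 1 / 2) - 1 / 2)
        = relu (tent^[n + 1] t - 1 / 2) := by
      rw [Function.iterate_succ_apply']; rfl
    have r {t : ℝ} (ht : t ∈ Set.Icc (0 : ℝ) 1) :
        relu (dyadicSq n t - (1 / 4) ^ (n + 1) *
          (2 * tent^[n] t - 4 * relu (tent^[n] t - 1 / 2))) = dyadicSq (n + 1) t := by
      rw [← tent, ← dyadicSq_succ]
      exact relu_of_nonneg ((sq_nonneg t).trans (sq_le_dyadicSq ht _))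
    funext i
    simp only [tentSteps, ih]
    fin_cases i
    exacts [a hx, b x, r hx, a hy, b y, r hy, a hw, b w, r hw, relu_of_nonneg hq]

/-- The state holding the pair `(z, p)`. -/
noncomputable def pairState (z p : ℝ) : Fin 10 → ℝ := ![z, p, 0, 0, 0, 0, 0, 0, 0, 0]

theorem start_pairState {z p : ℝ} (hz : 0 ≤ z) (hp : 0 ≤ p) :
    (fun i => relu (startForms i (pairState z p)))
      = tentState 0 z p (1 / 2 * p + 1 / 4 * z + 1 / 4) z := by
  have m : (0 : ℝ) ≤ 1 / 2 * p + 1 / 4 * z + 1 / 4 := by positivity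
  have e (t : ℝ) : t = dyadicSq 0 t := (dyadicSq_zero t).symm
  funext i
  fin_cases i
  exacts [relu_of_nonneg hz, rfl, (relu_of_nonneg hz).trans (e _), relu_of_nonneg hp, rfl,
    (relu_of_nonneg hp).trans (e _), relu_of_nonneg m, rfl, (relu_of_nonneg m).trans (e _),
    relu_of_nonneg hz]

/-! ### The approximate squaring and multiplication step -/

/-- One approximate step of `(z, p) ↦ (z ^ 2, p * ((1 + z) / 2))`. -/
noncomputable def sqMulStep (n : ℕ) (s : Fin 10 → ℝ) : Fin 10 → ℝ := fun i =>
  relu (complForms i fun i => relu (readForms i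
    (tentSteps n fun i => relu (startForms i s))))

theorem isReluBlock_sqMulStep (n : ℕ) : IsReluBlock 8 (n + 3) (sqMulStep n) := by
  have h := (IsReluBlock.layer (by norm_num) isBoundedAffine_complForms).comp
    ((IsReluBlock.layer (by norm_num) isBoundedAffine_readForms).comp
      ((isReluBlock_tentSteps n).comp
        (IsReluBlock.layer (by norm_num) isBoundedAffine_startForms)))
  rwa [show 1 + (1 + (n + 1)) = n + 3 by omega] at h

theorem relu_one_sub_relu_mem (u : ℝ) : relu (1 - relu (1 - u)) ∈ Set.Icc (0 : ℝ) 1 := by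
  refine ⟨relu_nonneg _, max_le ?_ zero_le_one⟩
  linarith [relu_nonneg (1 - u)]

/-- Truncation to `[0, 1]` is 1-Lipschitz and fixes `v`. -/
theorem abs_relu_one_sub_relu_sub_le {u v : ℝ} (hv : v ∈ Set.Icc (0 : ℝ) 1) :
    |relu (1 - relu (1 - u)) - v| ≤ |u - v| := by
  obtain ⟨h0, h1⟩ := hv
  unfold relu
  rcases max_cases (1 - u) 0 with ⟨h, _⟩ | ⟨h, _⟩ <;> rw [h]
  · rcases max_cases (1 - (1 - u)) 0 with ⟨h', _⟩ | ⟨h', _⟩ <;> rw [h']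
    · simp
    · rw [abs_of_nonpos (by linarith), abs_of_nonpos (by linarith)]; linarith
  · rw [max_eq_left (by norm_num), abs_of_nonneg (by linarith), abs_of_nonneg (by linarith)]
    linarith

theorem exists_sqMulStep_pairState {z p : ℝ} (hz : z ∈ Set.Icc (0 : ℝ) 1)
    (hp : p ∈ Set.Icc (0 : ℝ) 1) (n : ℕ) :
    ∃ z' ∈ Set.Icc (0 : ℝ) 1, ∃ p' ∈ Set.Icc (0 : ℝ) 1,
      sqMulStep n (pairState z p) = pairState z' p' ∧ |z' - z ^ 2| ≤ (1 / 4) ^ n ∧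
        |p' - p * ((1 + z) / 2)| ≤ (1 / 4) ^ n := by
  set m := 1 / 2 * p + 1 / 4 * z + 1 / 4 with hm
  have hm1 : m ∈ Set.Icc (0 : ℝ) 1 := by
    obtain ⟨_, _⟩ := hz; obtain ⟨_, _⟩ := hp
    constructor <;> linarith
  set v := 2 * dyadicSq n m - 1 / 2 * dyadicSq n p - 1 / 8 * (1 + 2 * z + dyadicSq n z) with hv
  have z1 := sq_le_dyadicSq hz n
  have z2 := dyadicSq_le z n
  have p1 := sq_le_dyadicSq hp n
  have p2 := dyadicSq_le p n
  have m1 := sq_le_dyadicSq hm1 n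
  have m2 := dyadicSq_le m n
  -- Polarization: `m` is the mean of `p` and `(1 + z) / 2`. The square of the latter only involves
  -- `z ^ 2`, so three squarings suffice.
  have hpol : p * ((1 + z) / 2) = 2 * m ^ 2 - 1 / 2 * p ^ 2 - 1 / 8 * (1 + 2 * z + z ^ 2) := by
    rw [hm]; ring
  have hpos : (0 : ℝ) < (1 / 4) ^ n := by positivity
  refine ⟨_, relu_one_sub_relu_mem (dyadicSq n z), _, relu_one_sub_relu_mem v, ?_, ?_, ?_⟩
  · have h0 : relu 0 = 0 := relu_of_nonneg le_rfl
    unfold sqMulStep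
    rw [start_pairState hz.1 hp.1, tentSteps_tentState hz hp hm1 hz.1]
    funext i
    fin_cases i
    exacts [rfl, rfl, h0, h0, h0, h0, h0, h0, h0, h0]
  · refine (abs_relu_one_sub_relu_sub_le
      ⟨sq_nonneg z, pow_le_one₀ hz.1 hz.2⟩).trans (abs_le.2 ⟨?_, ?_⟩) <;> linarith
  · refine (abs_relu_one_sub_relu_sub_le
      ⟨mul_nonneg hp.1 (by linarith [hz.1]), ?_⟩).trans (abs_le.2 ⟨?_, ?_⟩)
    · exact mul_le_one₀ hp.2 (by linarith [hz.1]) (by linarith [hz.2])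
    · rw [hpol]; linarith
    · rw [hpol]; linarith

/-! ### The geometric product and error propagation -/

/-- The product `∏_{i < k} (1 + z ^ (2 ^ i)) / 2`. -/
noncomputable def geomProd (z : ℝ) : ℕ → ℝ
  | 0 => 1
  | k + 1 => geomProd z k * ((1 + z ^ 2 ^ k) / 2)

theorem geomProd_mul (z : ℝ) (k : ℕ) :
    geomProd z k * (1 - z) = (1 / 2) ^ k * (1 - z ^ 2 ^ k) := by
  induction k with
  | zero => simp [geomProd]
  | succ k ih =>
    rw [geomProd, pow_succ 2 k, pow_mul, pow_succ (1 / 2 : ℝ)]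
    linear_combination ((1 + z ^ 2 ^ k) / 2) * ih

theorem geomProd_mem {z : ℝ} (hz : z ∈ Set.Icc (0 : ℝ) 1) (k : ℕ) :
    geomProd z k ∈ Set.Icc (0 : ℝ) 1 := by
  induction k with
  | zero => simp [geomProd]
  | succ k ih =>
    have h0 : 0 ≤ z ^ 2 ^ k := pow_nonneg hz.1 _
    have h1 : z ^ 2 ^ k ≤ 1 := pow_le_one₀ hz.1 hz.2
    exact ⟨mul_nonneg ih.1 (by linarith), mul_le_one₀ ih.2 (by linarith) (by linarith)⟩

/-- As all quantities lie in `[0, 1]`, a step turns an error bound `e` into at most `2 * e + (1 / 4)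
^ n`; the bound `(4 ^ k - 1) * (1 / 4) ^ n` absorbs this with room to spare. -/
theorem exists_sqMulStep_iterate {z : ℝ} (hz : z ∈ Set.Icc (0 : ℝ) 1) (n k : ℕ) :
    ∃ z' ∈ Set.Icc (0 : ℝ) 1, ∃ p' ∈ Set.Icc (0 : ℝ) 1,
      (sqMulStep n)^[k] (pairState z 1) = pairState z' p' ∧
        |z' - z ^ 2 ^ k| ≤ (4 ^ k - 1) * (1 / 4) ^ n ∧
        |p' - geomProd z k| ≤ (4 ^ k - 1) * (1 / 4) ^ n := by
  induction k with
  | zero => exact ⟨z, hz, 1, by simp, rfl, by simp, by simp [geomProd]⟩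
  | succ k ih =>
    obtain ⟨z', hz', p', hp', he, h1, h2⟩ := ih
    obtain ⟨z'', hz'', p'', hp'', he', g1, g2⟩ := exists_sqMulStep_pairState hz' hp' n
    refine ⟨z'', hz'', p'', hp'', by rw [Function.iterate_succ_apply', he, he'], ?_, ?_⟩
    all_goals
      set a := z ^ 2 ^ k
      set η : ℝ := (1 / 4) ^ n
      have hη : 0 ≤ η := by positivity
      have ha0 : 0 ≤ a := pow_nonneg hz.1 _
      have ha1 : a ≤ 1 := pow_le_one₀ hz.1 hz.2
      have h4 : (1 : ℝ) ≤ 4 ^ k := one_le_pow₀ (by norm_num)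
      have h4η : 0 ≤ (4 ^ k - 1) * η := mul_nonneg (by linarith) hη
    · have e : z'' - z ^ 2 ^ (k + 1) = (z'' - z' ^ 2) + (z' - a) * (z' + a) := by
        rw [pow_succ 2 k, pow_mul]; ring
      have : |(z' - a) * (z' + a)| ≤ (4 ^ k - 1) * η * 2 := by
        rw [abs_mul, abs_of_nonneg (by linarith [hz'.1] : 0 ≤ z' + a)]
        exact mul_le_mul h1 (by linarith [hz'.2]) (by linarith [hz'.1]) h4η
      rw [e, pow_succ 4 k]
      refine (abs_add_le _ _).trans ?_
      nlinarith
    · set q := geomProd z k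
      have hq := geomProd_mem hz k
      have e : p'' - geomProd z (k + 1)
          = (p'' - p' * ((1 + z') / 2)) + ((p' - q) * ((1 + z') / 2) + q * ((z' - a) / 2)) := by
        simp only [geomProd]; ring
      have u1 : |(p' - q) * ((1 + z') / 2)| ≤ (4 ^ k - 1) * η * 1 := by
        rw [abs_mul, abs_of_nonneg (by linarith [hz'.1] : 0 ≤ (1 + z') / 2)]
        exact mul_le_mul h2 (by linarith [hz'.2]) (by linarith [hz'.1]) h4η
      have u2 : |q * ((z' - a) / 2)| ≤ 1 * ((4 ^ k - 1) * η) := by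
        rw [abs_mul, abs_of_nonneg hq.1]
        refine mul_le_mul hq.2 ?_ (abs_nonneg _) zero_le_one
        rw [abs_div, abs_two]
        linarith [abs_nonneg (z' - a)]
      rw [e, pow_succ 4 k]
      refine (abs_add_le _ _).trans ?_
      have := abs_add_le ((p' - q) * ((1 + z') / 2)) (q * ((z' - a) / 2))
      nlinarith

theorem double_iterate {z p : ℝ} (hz : 0 ≤ z) (hp : 0 ≤ p) (k : ℕ) :
    (fun s i => relu (doubleForms i s))^[k] (pairState z p) = pairState z (2 ^ k * p) := by
  induction k with
  | zero => simp
  | succ k ih =>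
    rw [Function.iterate_succ_apply', ih]
    have h0 : relu 0 = 0 := relu_of_nonneg le_rfl
    have h : relu (2 * (2 ^ k * p)) = 2 ^ (k + 1) * p := by
      rw [relu_of_nonneg (by positivity)]; ring
    funext i
    fin_cases i
    exacts [relu_of_nonneg hz, h, h0, h0, h0, h0, h0, h0, h0, h0]

/-! ### Assembling the network -/

/-- The network with output `s 1`. -/
noncomputable def outputNet : DNN 10 1 := .affine (Matrix.of fun _ => Pi.single 1 1) 0

/-- The `+ 2` in the depth counts the input layer and the final affine map. -/
theorem exists_net_iterate_sqMulStep (N n k l : ℕ) :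
    ∃ Φ : DNN 1 1, Φ.depth = l + k * (n + 3) + 2 ∧ Φ.width ≤ 13 ∧ Φ.weightBound ≤ 8 ∧
      ∀ x, Φ.reluFun x = (fun s i => relu (doubleForms i s))^[l]
        ((sqMulStep n)^[k] (pairState (relu (1 - (1 / 2) ^ N * x)) 1)) 1 := by
  have hin : IsReluBlock 8 1 _ := IsReluBlock.layer (by norm_num)
    (isBoundedAffine_inputForms (a := (1 / 2) ^ N) (by positivity)
      (pow_le_one₀ (by norm_num) (by norm_num)))
  have hd : IsReluBlock 8 1 _ := IsReluBlock.layer (by norm_num) isBoundedAffine_doubleForms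
  obtain ⟨Φ, h1, h2, h3, h4⟩ := ((hd.iterate l).comp
    (((isReluBlock_sqMulStep n).iterate k).comp hin)) outputNet
  refine ⟨Φ, ?_, ?_, ?_, fun x => ?_⟩
  · rw [h1]; simp [outputNet, depth]; omega
  · refine h2.trans ?_; simp [outputNet, width]
  · refine h3.trans (max_le le_rfl (max_le (entryNorm_le (by norm_num) fun i j => ?_) ?_))
    · by_cases h : j = 1
      · subst h; simp
      · simp [h]
    · simp
  · have hx : (fun i => relu (inputForms ((1 / 2) ^ N) i fun _ => x))
        = pairState (relu (1 - (1 / 2) ^ N * x)) 1 := by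
      have h0 : relu 0 = 0 := relu_of_nonneg le_rfl
      funext i
      fin_cases i
      exacts [rfl, relu_of_nonneg zero_le_one, h0, h0, h0, h0, h0, h0, h0, h0]
    rw [reluFun, h4]
    beta_reduce
    rw [hx]
    simp [outputNet, realize, Matrix.mulVec, dotProduct, Pi.single_apply]

/-! ### Truncation error and choice of parameters -/

/-- From `z ≤ exp (-2 ^ (-N))`, the power `4 ^ N` gives `exp (-2 ^ N) ≤ exp (-N) ≤ 2 ^ (-N)`. -/
theorem one_sub_pow_two_pow_le (N : ℕ) {z : ℝ} (h0 : 0 ≤ z) (h1 : z ≤ 1 - (1 / 2) ^ N) :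
    z ^ 2 ^ (2 * N) ≤ (1 / 2) ^ N := by
  have h2 : z ≤ Real.exp (-(1 / 2) ^ N) := h1.trans (by
    linarith [Real.add_one_le_exp (-(1 / 2 : ℝ) ^ N)])
  have h3 : z ^ 2 ^ (2 * N) ≤ Real.exp (-(2 : ℝ) ^ N) := by
    refine (pow_le_pow_left₀ h0 h2 _).trans (le_of_eq ?_)
    rw [← Real.exp_nat_mul]
    congr 1
    push_cast
    rw [two_mul, pow_add, mul_neg, mul_assoc, ← mul_pow]
    norm_num
  have h4 : Real.exp (-(2 : ℝ) ^ N) ≤ Real.exp (-(N : ℝ)) := by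
    refine Real.exp_le_exp.2 (neg_le_neg ?_)
    exact_mod_cast Nat.lt_two_pow_self.le
  have h5 : Real.exp (-(N : ℝ)) ≤ (1 / 2) ^ N := by
    rw [← mul_one (N : ℝ), ← mul_neg, Real.exp_nat_mul]
    refine pow_le_pow_left₀ (Real.exp_pos _).le ?_ _
    rw [Real.exp_neg, one_div]
    exact inv_anti₀ two_pos (by linarith [Real.add_one_le_exp (1 : ℝ)])
  linarith

theorem abs_inv_sub_geomProd_le (N : ℕ) {x : ℝ} (hx : 1 < x) :
    |1 / x - 2 ^ N * geomProd (relu (1 - (1 / 2) ^ N * x)) (2 * N)| ≤ (1 / 2) ^ N := by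
  set z := relu (1 - (1 / 2) ^ N * x) with hz
  have hpos : (0 : ℝ) < (1 / 2) ^ N := by positivity
  have hN : (2 : ℝ) ^ N * (1 / 2) ^ N = 1 := by rw [← mul_pow]; norm_num
  have hx0 : 0 < x := by linarith
  have hgm := geomProd_mul z (2 * N)
  have hK : (2 : ℝ) ^ N * (1 / 2) ^ (2 * N) = (1 / 2) ^ N := by
    rw [two_mul, pow_add, ← mul_assoc, hN, one_mul]
  rcases le_total ((1 / 2) ^ N * x) 1 with h | h
  · have hz' : z = 1 - (1 / 2) ^ N * x := relu_of_nonneg (by linarith)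
    have hz0 : 0 ≤ z := relu_nonneg _
    have hb := one_sub_pow_two_pow_le N hz0 (by rw [hz']; nlinarith)
    have hzp : 0 ≤ z ^ 2 ^ (2 * N) := pow_nonneg hz0 _
    have e : 2 ^ N * geomProd z (2 * N) * x = 1 - z ^ 2 ^ (2 * N) := by
      have h1z : 1 - z = (1 / 2) ^ N * x := by rw [hz']; ring
      rw [h1z] at hgm
      have : (1 / 2 : ℝ) ^ N * (2 ^ N * geomProd z (2 * N) * x)
          = (1 / 2) ^ N * (1 - z ^ 2 ^ (2 * N)) := by
        linear_combination 2 ^ N * hgm + (1 - z ^ 2 ^ (2 * N)) * hK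
      exact mul_left_cancel₀ hpos.ne' this
    have e2 : 1 / x - 2 ^ N * geomProd z (2 * N) = z ^ 2 ^ (2 * N) / x := by
      field_simp
      linarith
    rw [e2, abs_of_nonneg (by positivity)]
    exact (div_le_self hzp hx.le).trans hb
  · have hz' : z = 0 := max_eq_right (by linarith)
    rw [hz'] at hgm ⊢
    have e : (2 : ℝ) ^ N * geomProd 0 (2 * N) = (1 / 2) ^ N := by
      rw [sub_zero, mul_one, zero_pow (by positivity), sub_zero, mul_one] at hgm
      rw [hgm, hK]
    have h1x : 1 / x ≤ (1 / 2) ^ N := by rw [div_le_iff₀ hx0]; exact h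
    have : 0 < 1 / x := by positivity
    rw [e, abs_le]
    constructor <;> linarith

theorem exists_net_inv (N : ℕ) :
    ∃ Φ : DNN 1 1, Φ.depth = N + 2 * N * (4 * N + 3) + 2 ∧ Φ.width ≤ 13 ∧ Φ.weightBound ≤ 8 ∧
      ∀ x, 1 < x → |1 / x - Φ.reluFun x| ≤ 2 * (1 / 2) ^ N := by
  -- With `k = 2N` steps the error grows by at most `4 ^ (2N)`; `n = 4N` leaves `4 ^ (-2N)`, small
  -- enough to survive the final factor `2 ^ N`.
  obtain ⟨Φ, h1, h2, h3, h4⟩ := exists_net_iterate_sqMulStep N (4 * N) (2 * N) N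
  refine ⟨Φ, h1, h2, h3, fun x hx => ?_⟩
  have ht := abs_inv_sub_geomProd_le N hx
  have hpos : (0 : ℝ) < (1 / 2) ^ N := by positivity
  have hz : relu (1 - (1 / 2) ^ N * x) ∈ Set.Icc (0 : ℝ) 1 :=
    ⟨relu_nonneg _, max_le (by nlinarith) zero_le_one⟩
  rw [h4]
  set z := relu (1 - (1 / 2) ^ N * x)
  obtain ⟨z', hz', p', hp', he, -, h⟩ := exists_sqMulStep_iterate hz (4 * N) (2 * N)
  rw [he, double_iterate hz'.1 hp'.1]
  have hp : |p' - geomProd z (2 * N)| ≤ (1 / 2) ^ N * (1 / 2) ^ N := by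
    refine h.trans ?_
    have e : (4 : ℝ) ^ (2 * N) * (1 / 4) ^ (4 * N) = (1 / 4) ^ (2 * N) := by
      rw [show 4 * N = 2 * N + 2 * N by ring, pow_add, ← mul_assoc, ← mul_pow]; norm_num
    have e2 : (1 / 4 : ℝ) ^ (2 * N) ≤ (1 / 4) ^ N :=
      pow_le_pow_of_le_one (by norm_num) (by norm_num) (by omega)
    have e3 : (1 / 2 : ℝ) ^ N * (1 / 2) ^ N = (1 / 4) ^ N := by rw [← mul_pow]; norm_num
    have : (0 : ℝ) < (1 / 4) ^ (4 * N) := by positivity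
    rw [e3]
    linarith
  have hs : |2 ^ N * geomProd z (2 * N) - 2 ^ N * p'| ≤ (1 / 2) ^ N := by
    rw [← mul_sub, abs_mul, abs_of_pos (by positivity : (0 : ℝ) < 2 ^ N), abs_sub_comm]
    refine (mul_le_mul_of_nonneg_left hp (by positivity)).trans (le_of_eq ?_)
    rw [← mul_assoc, ← mul_pow]
    norm_num
  change |1 / x - 2 ^ N * p'| ≤ _
  linarith [abs_sub_le (1 / x) (2 ^ N * geomProd z (2 * N)) (2 ^ N * p')]

theorem exists_nat_half_pow_le {ε : ℝ} (h0 : 0 < ε) (h1 : ε < 1 / 3) :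
    ∃ N : ℕ, 1 ≤ N ∧ 2 * (1 / 2 : ℝ) ^ N ≤ ε ∧ (N : ℝ) ≤ 4 * Real.log (1 / ε) ∧
      1 ≤ Real.log (1 / ε) := by
  have hl : 1 ≤ Real.log (1 / ε) := by
    rw [Real.le_log_iff_exp_le (by positivity)]
    have : 3 < 1 / ε := by rw [lt_div_iff₀ h0]; linarith
    linarith [Real.exp_one_lt_d9]
  set l := Real.log (1 / ε) with hl_def
  have hε : Real.exp (-l) = ε := by rw [hl_def, one_div, Real.log_inv, neg_neg, Real.exp_log h0]
  have hlog := Real.log_two_gt_d9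
  -- Since `log 2 > 1 / 2`, the exponent `⌈2 * l⌉₊` already gives `ε`; the extra `1` cancels the
  -- factor `2`.
  refine ⟨⌈2 * l⌉₊ + 1, by omega, ?_, ?_, hl⟩
  · rw [pow_succ]
    have e : (1 / 2 : ℝ) ^ ⌈2 * l⌉₊ = Real.exp (⌈2 * l⌉₊ * (-Real.log 2)) := by
      rw [Real.exp_nat_mul, Real.exp_neg, Real.exp_log two_pos, one_div]
    have : Real.exp (⌈2 * l⌉₊ * (-Real.log 2)) ≤ Real.exp (-l) := by
      refine Real.exp_le_exp.2 ?_
      have := Nat.le_ceil (2 * l)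
      nlinarith
    rw [e]
    linarith
  · have := Nat.ceil_lt_add_one (by linarith : 0 ≤ 2 * l)
    push_cast
    linarith

theorem lemma3p6 :
    ∃ C : ℝ, 0 < C ∧ ∃ B : ℝ, 0 < B ∧ ∃ ε₀ : ℝ, 0 < ε₀ ∧
      ∀ D : ℝ, 1 < D → ∀ ε : ℝ, 0 < ε → ε < ε₀ →
        ∃ L : ℕ, ∃ Φ ∈ NN L 13 1 1,
          (L : ℝ) ≤ C * (Real.log (1 / ε)) ^ 2 *
            ((⌈Real.log D⌉ : ℝ) ^ 2 + (Real.log (1 / ε)) ^ 2) ∧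
          MeasureTheory.eLpNorm (fun x : ℝ => 1 / x - Φ.reluFun x) ⊤
            (MeasureTheory.volume.restrict (Set.Ioo 1 D)) ≤ ENNReal.ofReal ε ∧
          Φ.weightBound ≤ B := by
  -- `272 = 17 * 4 ^ 2`, from depth at most `17 * N ^ 2` and `N ≤ 4 * log (1 / ε)`. The threshold `1
  -- / 3` ensures `log (1 / ε) ≥ 1`, so the factor containing `D` is at least `1`.
  refine ⟨272, by norm_num, 8, by norm_num, 1 / 3, by norm_num, fun D _ ε h0 h1 => ?_⟩
  obtain ⟨N, hN1, hNε, hNl, hl⟩ := exists_nat_half_pow_le h0 h1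
  obtain ⟨Φ, hd, hw, hb, hΦ⟩ := exists_net_inv N
  refine ⟨Φ.depth, Φ, ⟨le_rfl, hw⟩, ?_, ?_, hb⟩
  · set l := Real.log (1 / ε)
    have hN : (1 : ℝ) ≤ N := by exact_mod_cast hN1
    have hdepth : (Φ.depth : ℝ) ≤ 17 * (N : ℝ) ^ 2 := by
      rw [hd]; push_cast; nlinarith
    have hsq : (N : ℝ) ^ 2 ≤ (4 * l) ^ 2 := pow_le_pow_left₀ (by linarith) hNl 2
    have hl2 : 1 ≤ l ^ 2 := one_le_pow₀ hl
    have hD : 1 ≤ (⌈Real.log D⌉ : ℝ) ^ 2 + l ^ 2 := by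
      linarith [sq_nonneg (⌈Real.log D⌉ : ℝ)]
    have := mul_le_mul_of_nonneg_left hD (by positivity : 0 ≤ 272 * l ^ 2)
    linarith
  · rw [MeasureTheory.eLpNorm_exponent_top]
    refine MeasureTheory.eLpNormEssSup_le_of_ae_bound ?_
    filter_upwards [MeasureTheory.ae_restrict_mem measurableSet_Ioo] with x hx
    rw [Real.norm_eq_abs]
    exact (hΦ x hx.1).trans hNε
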